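/- Morse Dynamical Characterization Theorem. Let $\sigma$ denote the shift, $(\sigma x)_i = x_{i+1}$, on bilaterally infinite sequences over a finite alphabet. A symbolic minimal set $(X,\sigma)$ is a nonempty closed shift-invariant set $X$ of such sequences that has no nonempty proper closed shift-invariant subset. Let $t_0t_1t_2\dots = 0110\,1001\,1001\,0110\dots$ be the Prouhet–Thue–Morse sequence ($t_n$ is the parity of the number of ones in the binary expansion of $n$), and let $m$ be the two-sided sequence with $m_n = t_n$ and $m_{-n-1} = t_n$ for $n \ge 0$. The Morse minimal set is $M = \overline{\{\sigma^n(m) : n \in \mathbb{Z}\}} \subseteq \{0,1\}^{\mathbb{Z}}$. For blocks $C_0 \ne C_1$, $C_0'$, $C_1'$ of a common length $2^k$, say that a point $x$ satisfies $P(C_0,C_1,C_0',C_1')$ if $x$ can be written as a concatenation (with an arbitrary starting place) of the blocks $C_0, C_1, C_0', C_1'$ such that (i) every second block in the concatenation is $C_0$ or $C_1$, and the sequence of these blocks, thought of as a bilaterally infinite sequence with letters $C_0$ and $C_1$, contains no block of the form $BBb$, where $B$ is a nonempty block and $b$ is the first letter of $B$; (ii) the remaining blocks (the gaps) are filled in according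 to the nearest neighbour rule: $C_0$ goes between $C_1$ and $C_1$; $C_1$ goes between $C_0$ and $C_0$; $C_0'$ goes between $C_1$ (on the left) and $C_0$ (on the right); $C_1'$ goes between $C_0$ (on the left) and $C_1$ (on the right). Let $(X,\sigma)$ be a symbolic minimal set. Then the following are equivalent: (a) $(X,\sigma)$ is topologically conjugate to the Morse minimal set $(M,\sigma)$; (b) there exist $k \ge 0$ and $2^k$-blocks $C_0 \ne C_1$, $C_0'$, $C_1'$ such that some point of $X$ satisfies $P(C_0,C_1,C_0',C_1')$; (c) there exist $k \ge 0$ and $2^k$-blocks $C_0 \ne C_1$, $C_0'$, $C_1'$ such that every point of $X$ satisfies $P(C_0,C_1,C_0',C_1')$. Moreover, for all $k \ge 0$ and all $2^k$-blocks $C_0 \ne C_1$, $C_0'$, $C_1'$, if some point of $X$ satisfies $P(C_0,C_1,C_0',C_1')$, then every point of $X$ does. -/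

import Mathlib

open SymbolicDynamics.FullShift

/-- The one-sided Prouhet-Thue-Morse sequence `0110 1001 1001 0110 …`: the `n`-th letter is the
parity of the number of ones in the binary expansion of `n`. -/
def thueMorse (n : ℕ) : Fin 2 := Fin.ofNat 2 (Nat.digits 2 n).sum

/-- `thueMorse` is the fixed point, starting with `0`, of the substitution `0 ↦ 01`, `1 ↦ 10`. -/
theorem thueMorse_substitution :
    thueMorse 0 = 0 ∧ ∀ n, thueMorse (2 * n) = thueMorse n ∧
      thueMorse (2 * n + 1) = 1 - thueMorse n := by
  have hodd : ∀ a : ℕ, Fin.ofNat 2 (1 + a) = 1 - Fin.ofNat 2 a := by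
    intro a
    rcases Nat.mod_two_eq_zero_or_one a with h | h <;>
      (apply Fin.ext; simp [Fin.ofNat, Nat.add_mod, h])
  refine ⟨by simp [thueMorse], fun n => ⟨?_, ?_⟩⟩
  · rcases Nat.eq_zero_or_pos n with rfl | hn
    · simp
    · simp [thueMorse, Nat.digits_def' (b := 2) (by norm_num) (show 0 < 2 * n by omega)]
  · have h : Nat.digits 2 (2 * n + 1) = 1 :: Nat.digits 2 n := by
      rw [Nat.digits_def' (b := 2) (by norm_num) (show 0 < 2 * n + 1 by omega)]
      congr 1
      · omega
      · congr 1; omega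
    rw [thueMorse, h, List.sum_cons, hodd, thueMorse]

/-- The two-sided Morse sequence `… 1001 0110 . 0110 1001 …`; its left half is the mirror image of
its right half. -/
def morseSeq : ℤ → Fin 2
  | Int.ofNat n => thueMorse n
  | Int.negSucc n => thueMorse n

/-- The orbit closure of a bilateral sequence under the shift `(shift 1 x) i = x (1 + i)`. -/
def orbitClosure {A : Type*} [TopologicalSpace A] (x : ℤ → A) : Subshift A ℤ where
  carrier := closure (Set.range fun n : ℤ => shift n x)
  isClosed := isClosed_closure
  mapsTo g := by
    refine Set.MapsTo.closure ?_ (continuous_shift g)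
    rintro _ ⟨n, rfl⟩
    exact ⟨n + g, shift_add n g x⟩

/-- The Morse minimal set. -/
def morseMinimalSet : Subshift (Fin 2) ℤ := orbitClosure morseSeq

/-- A subshift is a (symbolic) minimal set if it is nonempty and has no nonempty proper closed
shift-invariant subset. -/
def IsMinimalSet {A : Type*} [TopologicalSpace A] (X : Subshift A ℤ) : Prop :=
  X.carrier.Nonempty ∧
    ∀ Y : Subshift A ℤ, Y.carrier.Nonempty → Y.carrier ⊆ X.carrier → Y.carrier = X.carrier

/-- The shift `σ` on a two-sided subshift. -/
def subshiftMap {A : Type*} [TopologicalSpace A] (X : Subshift A ℤ) : X.carrier → X.carrier :=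
  (X.mapsTo 1).restrict (shift 1) X.carrier X.carrier

/-- Topological conjugacy of `(X, σ)` and `(Y, σ)`. -/
def TopConjugate {A B : Type*} [TopologicalSpace A] [TopologicalSpace B]
    (X : Subshift A ℤ) (Y : Subshift B ℤ) : Prop :=
  ∃ h : X.carrier ≃ₜ Y.carrier, Function.Semiconj h (subshiftMap X) (subshiftMap Y)

/-- The finite word `w` appears in the bilateral sequence `s`. -/
def WordAppears {S : Type*} (w : List S) (s : ℤ → S) : Prop :=
  ∃ i : ℤ, ∀ (j : ℕ) (hj : j < w.length), s (i + j) = w[j]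

/-- `s` contains no word of the form `BBb`, where `b` is the first letter of `B = b :: B'`. -/
def NoBBb {S : Type*} (s : ℤ → S) : Prop :=
  ∀ (b : S) (B' : List S), ¬ WordAppears ((b :: B') ++ (b :: B') ++ [b]) s

/-- `x` is the concatenation `… (c (-1)) (c 0) (c 1) …` of blocks of length `L`, where the block
`c 0` starts at some (arbitrary) place `p`. -/
def IsConcatenation {A : Type*} {L : ℕ} (c : ℤ → Fin L → A) (x : ℤ → A) : Prop :=
  ∃ p : ℤ, ∀ (n : ℤ) (i : Fin L), x (p + L * n + (i : ℕ)) = c n i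

/-- `x` is a concatenation of the blocks `C₀, C₁, C₀', C₁'` in which every second block is `C₀` or
`C₁`, these form a sequence without `BBb`, and the remaining blocks obey the nearest neighbour
rule. As `IsConcatenation` leaves the position of the block `c 0` free, it is no restriction that
the distinguished blocks are those of even index. -/
def MorseDecomposable {A : Type*} {L : ℕ} (C₀ C₁ C₀' C₁' : Fin L → A) (x : ℤ → A) : Prop :=
  ∃ c : ℤ → Fin L → A,
    IsConcatenation c x ∧
    (∀ n, c n = C₀ ∨ c n = C₁ ∨ c n = C₀' ∨ c n = C₁') ∧
    (∀ n, c (2 * n) = C₀ ∨ c (2 * n) = C₁) ∧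
    NoBBb (fun n => c (2 * n)) ∧
    (∀ n,
      (c (2 * n) = C₁ → c (2 * n + 2) = C₁ → c (2 * n + 1) = C₀) ∧
      (c (2 * n) = C₀ → c (2 * n + 2) = C₀ → c (2 * n + 1) = C₁) ∧
      (c (2 * n) = C₁ → c (2 * n + 2) = C₀ → c (2 * n + 1) = C₀') ∧
      (c (2 * n) = C₀ → c (2 * n + 2) = C₁ → c (2 * n + 1) = C₁'))

/-! Write θ for `morseSubst` and m for `morseSeq`. The Morse minimal set is exactly the set of
overlap-free two-sided binary sequences (`mem_morseMinimalSet`). Overlaps pull back through θ with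
half the period, so m, fixed by θ², is overlap-free by descent. Conversely, every overlap-free
sequence is a shift of θ of another one (`OverlapFree.exists_morseSubst`); iterating, any two
overlap-free sequences have the same words.

For (b) ⇒ (a): by `morseDecomposable_iff`, a point satisfies P iff it is a shift of `morseConcat` of
an overlap-free s. By minimality X consists of all such shifts, which also gives the last claim of
the theorem. The phase is determined modulo 2·2^k (`dvd_of_shift_morseConcat`), so X is a tower of
height 2^(k+1) over the overlap-free sequences. The map θ^(k+1) exhibits M as a tower of the same
height, and such towers are conjugate.

For (a) ⇒ (b): the inverse conjugacy M → X is a sliding block code, so for large k the 2^k-blocks of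
the image of θ^k(u), suitably offset, depend only on the pairs u_j u_{j+1}. For u = θ(m), the pairs
at even j are 01 or 10 and code the letters of m; the pairs at odd j straddle two letters of m,
which is the nearest neighbour rule. -/

/-! ### Overlaps and the condition on `BBb` -/

/-- The word of length `2 * p + 1` of `s` starting at `a` has the form `BBb` with `|B| = p`. -/
def IsOverlap {S : Type*} (s : ℤ → S) (a : ℤ) (p : ℕ) : Prop :=
  ∀ t : ℕ, t ≤ p → s (a + t) = s (a + t + p)

/-- A bilateral sequence without overlaps. -/
def OverlapFree {S : Type*} (s : ℤ → S) : Prop :=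
  ∀ (a : ℤ) (p : ℕ), 0 < p → ¬ IsOverlap s a p

theorem getElem_overlap {S : Type*} (b : S) (B : List S) (j : ℕ)
    (hj : j < ((b :: B) ++ (b :: B) ++ [b]).length) :
    ((b :: B) ++ (b :: B) ++ [b])[j] =
      (b :: B)[j % (B.length + 1)]'(by simpa using Nat.mod_lt _ (Nat.succ_pos _)) := by
  have hj' : j < (B.length + 1) + (B.length + 1) + 1 := by simp at hj; omega
  rcases lt_or_ge j (B.length + 1) with h | h
  · simp only [Nat.mod_eq_of_lt h]
    rw [List.getElem_append_left (by simp; omega), List.getElem_append_left (by simpa using h)]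
  rcases lt_or_ge j (B.length + 1 + (B.length + 1)) with h2 | h2
  · have e : j % (B.length + 1) = j - (B.length + 1) := by
      rw [Nat.mod_eq_sub_mod h, Nat.mod_eq_of_lt (by omega)]
    simp only [e]
    rw [List.getElem_append_left (by simp; omega), List.getElem_append_right (by simpa using h)]
    simp
  · have e : j % (B.length + 1) = 0 := by
      have : j = (B.length + 1) * 2 := by omega
      rw [this, Nat.mul_mod_right]
    simp only [e]
    rw [List.getElem_append_right (by simp; omega)]
    simp

theorem noBBb_iff_overlapFree {S : Type*} (s : ℤ → S) : NoBBb s ↔ OverlapFree s := by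
  constructor
  · intro h a p hp hov
    obtain ⟨q, rfl⟩ : ∃ q, p = q + 1 := ⟨p - 1, by omega⟩
    refine h (s a) (List.ofFn fun i : Fin q => s (a + (i + 1 : ℕ))) ⟨a, fun j hj => ?_⟩
    rw [getElem_overlap]
    simp only [List.length_ofFn]
    have hj' : j ≤ 2 * (q + 1) := by
      simp at hj; omega
    have key : s (a + j) = s (a + (j % (q + 1) : ℕ)) := by
      rcases lt_or_ge j (q + 1) with h1 | h1
      · rw [Nat.mod_eq_of_lt h1]
      · have e := hov (j - (q + 1)) (by omega)
        have e1 : a + ((j - (q + 1) : ℕ) : ℤ) + ((q + 1 : ℕ) : ℤ) = a + j := by omega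
        rw [e1] at e
        rw [← e, Nat.mod_eq_sub_mod h1]
        rcases lt_or_ge (j - (q + 1)) (q + 1) with h2 | h2
        · rw [Nat.mod_eq_of_lt h2]
        · have e3 : j - (q + 1) = q + 1 := by omega
          have := hov 0 (by omega)
          rw [e3, Nat.mod_self, this]
          simp
    rw [key]
    generalize_proofs hlt
    revert hlt
    generalize j % (q + 1) = m
    intro hlt
    rcases m with _ | m <;> simp
  · rintro h b B ⟨i, hi⟩
    refine h i (B.length + 1) (Nat.succ_pos _) fun t ht => ?_
    have h1 := hi t (by simp; omega)
    have h2 := hi (t + (B.length + 1)) (by simp; omega)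
    rw [getElem_overlap] at h1 h2
    simp only [Nat.add_mod_right] at h2
    rw [h1, ← h2]
    push_cast
    congr 1
    ring

theorem OverlapFree.comp_iff {S T : Type*} {f : S → T} (hf : Function.Injective f)
    {s : ℤ → S} : OverlapFree (fun n => f (s n)) ↔ OverlapFree s := by
  simp only [OverlapFree, IsOverlap, hf.eq_iff]

theorem OverlapFree.shift {S : Type*} {s : ℤ → S} (h : OverlapFree s) (n : ℤ) :
    OverlapFree (shift n s) := by
  intro a p hp hov
  refine h (n + a) p hp fun t ht => ?_
  have := hov t ht
  simpa only [shift_apply, add_assoc] using this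

/-! ### The substitution and the overlap-freeness of the Morse sequence -/

/-- The substitution `0 ↦ 01`, `1 ↦ 10` on bilateral sequences. -/
def morseSubst (s : ℤ → Fin 2) : ℤ → Fin 2 :=
  fun q => if q % 2 = 0 then s (q / 2) else 1 - s (q / 2)

theorem morseSubst_even (s : ℤ → Fin 2) (n : ℤ) : morseSubst s (2 * n) = s n := by
  simp [morseSubst]

theorem morseSubst_odd (s : ℤ → Fin 2) (n : ℤ) : morseSubst s (2 * n + 1) = 1 - s n := by
  have h1 : (2 * n + 1) % 2 = 1 := by omega
  have h2 : (2 * n + 1) / 2 = n := by omega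
  simp [morseSubst, h1, h2]

theorem fin_two_one_sub_ne (a : Fin 2) : 1 - a ≠ a := by decide +revert

theorem fin_two_ne_iff {a b : Fin 2} : a ≠ b ↔ b = 1 - a := by decide +revert

theorem morseSubst_ne (s : ℤ → Fin 2) {q : ℤ} (hq : q % 2 = 0) :
    morseSubst s q ≠ morseSubst s (q + 1) := by
  obtain ⟨n, rfl⟩ : ∃ n, q = 2 * n := ⟨q / 2, by omega⟩
  rw [morseSubst_even, morseSubst_odd]
  exact (fin_two_one_sub_ne _).symm

theorem morseSubst_injective : Function.Injective morseSubst := by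
  intro s t h
  funext n
  rw [← morseSubst_even s, h, morseSubst_even]

theorem shift_morseSubst (s : ℤ → Fin 2) (n : ℤ) :
    shift (2 * n) (morseSubst s) = morseSubst (shift n s) := by
  funext q
  have h1 : (2 * n + q) % 2 = q % 2 := by omega
  have h2 : (2 * n + q) / 2 = n + q / 2 := by omega
  simp [morseSubst, h1, h2]

/-- A sequence alternating on an interval takes different values at points of different parity. -/
theorem ne_of_alternating {s : ℤ → Fin 2} {a : ℤ} {p : ℕ}
    (h : ∀ t : ℕ, t < p → s (a + t) ≠ s (a + t + 1)) :
    ∀ t : ℕ, t ≤ p → s (a + t) = if t % 2 = 0 then s a else 1 - s a := by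
  intro t
  induction t with
  | zero => simp
  | succ t ih =>
    intro ht
    have h1 := fin_two_ne_iff.1 (h t (by omega))
    rw [ih (by omega)] at h1
    push_cast
    rw [← add_assoc, h1]
    rcases Nat.mod_two_eq_zero_or_one t with h2 | h2
    · simp [h2, show (t + 1) % 2 = 1 by omega]
    · simp [h2, show (t + 1) % 2 = 0 by omega]

/-- Overlaps in the image of the substitution come from overlaps of half the length. -/
theorem IsOverlap.of_morseSubst {s : ℤ → Fin 2} {a : ℤ} {p : ℕ}
    (h : IsOverlap (morseSubst s) a p) : ∃ p' a', p = 2 * p' ∧ IsOverlap s a' p' := by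
  rcases Nat.even_or_odd' p with ⟨p', hp | hp⟩
  · refine ⟨p', a / 2, hp, fun t ht => ?_⟩
    have h1 := h (2 * t) (by omega)
    rcases Int.even_or_odd' a with ⟨a', ha | ha⟩
    · have e1 : a + ((2 * t : ℕ) : ℤ) = 2 * (a / 2 + t) := by omega
      have e2 : 2 * (a / 2 + t) + (p : ℤ) = 2 * (a / 2 + t + p') := by omega
      rwa [e1, e2, morseSubst_even, morseSubst_even] at h1
    · have e1 : a + ((2 * t : ℕ) : ℤ) = 2 * (a / 2 + t) + 1 := by omega
      have e2 : 2 * (a / 2 + t) + 1 + (p : ℤ) = 2 * (a / 2 + t + p') + 1 := by omega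
      rw [e1, e2, morseSubst_odd, morseSubst_odd] at h1
      exact sub_right_injective h1
  · exfalso
    -- For odd p, translation by p carries a pair of neighbours straddling two cells to a pair
    -- inside one cell, where the letters differ. So the word alternates, and letters at the odd
    -- distance p differ.
    have alt : ∀ t : ℕ, t < p → morseSubst s (a + t) ≠ morseSubst s (a + t + 1) := by
      intro t ht heq
      rcases Int.emod_two_eq_zero_or_one (a + t) with he | ho
      · exact morseSubst_ne s he heq
      · refine morseSubst_ne s (q := a + t + p) (by omega) ?_
        have h1 := h t (by omega)
        have h2 := h (t + 1) (by omega)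
        push_cast at h2
        rw [← h1, heq, add_assoc, h2]
        congr 1; ring
    have h0 := ne_of_alternating alt p le_rfl
    have h1 := h 0 (by omega)
    rw [if_neg (by omega)] at h0
    simp only [Nat.cast_zero, add_zero] at h1
    rw [h0] at h1
    exact fin_two_one_sub_ne _ h1.symm

theorem IsOverlap.morseSubst {s : ℤ → Fin 2} {a : ℤ} {p : ℕ} (h : IsOverlap s a p) :
    IsOverlap (morseSubst s) (2 * a) (2 * p) := by
  intro t ht
  rcases Nat.even_or_odd' t with ⟨u, rfl | rfl⟩
  · have e1 : 2 * a + ((2 * u : ℕ) : ℤ) = 2 * (a + u) := by push_cast; ring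
    have e2 : 2 * (a + u) + ((2 * p : ℕ) : ℤ) = 2 * (a + u + p) := by push_cast; ring
    rw [e1, e2, morseSubst_even, morseSubst_even, h u (by omega)]
  · have e1 : 2 * a + ((2 * u + 1 : ℕ) : ℤ) = 2 * (a + u) + 1 := by push_cast; ring
    have e2 : 2 * (a + u) + 1 + ((2 * p : ℕ) : ℤ) = 2 * (a + u + p) + 1 := by push_cast; ring
    rw [e1, e2, morseSubst_odd, morseSubst_odd, h u (by omega)]

theorem OverlapFree.morseSubst {s : ℤ → Fin 2} (h : OverlapFree s) :
    OverlapFree (morseSubst s) := by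
  intro a p hp hov
  obtain ⟨p', a', rfl, h'⟩ := hov.of_morseSubst
  exact h a' p' (by omega) h'

theorem OverlapFree.of_morseSubst {s : ℤ → Fin 2} (h : OverlapFree (_root_.morseSubst s)) :
    OverlapFree s := fun a p hp hov => h _ _ (by omega) hov.morseSubst

theorem morseSubst_morseSeq_natCast (n : ℕ) : morseSubst morseSeq n = morseSeq n := by
  obtain ⟨m, rfl | rfl⟩ := Nat.even_or_odd' n
  · push_cast
    rw [morseSubst_even]
    exact ((thueMorse_substitution.2 m).1).symm
  · push_cast
    rw [morseSubst_odd]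
    exact ((thueMorse_substitution.2 m).2).symm

/-- Reversing a cell complements it, so θ fixes the right half of m but complements the mirrored
left half; only θ² fixes the whole sequence. -/
theorem morseSubst_morseSeq_negSucc (n : ℕ) :
    morseSubst morseSeq (Int.negSucc n) = 1 - morseSeq (Int.negSucc n) := by
  obtain ⟨m, rfl | rfl⟩ := Nat.even_or_odd' n
  · rw [show Int.negSucc (2 * m) = 2 * Int.negSucc m + 1 by omega, morseSubst_odd,
      show 2 * Int.negSucc m + 1 = Int.negSucc (2 * m) by omega]
    exact congrArg (1 - ·) ((thueMorse_substitution.2 m).1).symm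
  · rw [show Int.negSucc (2 * m + 1) = 2 * Int.negSucc m by omega, morseSubst_even,
      show 2 * Int.negSucc m = Int.negSucc (2 * m + 1) by omega]
    change thueMorse m = 1 - thueMorse (2 * m + 1)
    rw [(thueMorse_substitution.2 m).2]
    simp

theorem morseSubst_morseSubst_morseSeq : morseSubst (morseSubst morseSeq) = morseSeq := by
  have hpos : ∀ n : ℕ, morseSubst (morseSubst morseSeq) n = morseSeq n := by
    intro n
    rw [← morseSubst_morseSeq_natCast]
    obtain ⟨m, rfl | rfl⟩ := Nat.even_or_odd' n
    · push_cast
      rw [morseSubst_even, morseSubst_even, morseSubst_morseSeq_natCast]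
    · push_cast
      rw [morseSubst_odd, morseSubst_odd, morseSubst_morseSeq_natCast]
  funext q
  rcases q with n | n
  · exact hpos n
  · obtain ⟨m, rfl | rfl⟩ := Nat.even_or_odd' n
    · rw [show Int.negSucc (2 * m) = 2 * Int.negSucc m + 1 by omega, morseSubst_odd,
        morseSubst_morseSeq_negSucc,
        show 2 * Int.negSucc m + 1 = Int.negSucc (2 * m) by omega]
      rw [sub_sub_cancel]
      exact ((thueMorse_substitution.2 m).1).symm
    · rw [show Int.negSucc (2 * m + 1) = 2 * Int.negSucc m by omega, morseSubst_even,
        morseSubst_morseSeq_negSucc,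
        show 2 * Int.negSucc m = Int.negSucc (2 * m + 1) by omega]
      exact ((thueMorse_substitution.2 m).2).symm

theorem overlapFree_morseSeq : OverlapFree morseSeq := by
  -- Since θ exchanges m and θ(m), the descent on the period runs on both sequences at once.
  suffices h : ∀ n p : ℕ, p < n → 0 < p → ∀ a, ¬ IsOverlap morseSeq a p ∧
      ¬ IsOverlap (morseSubst morseSeq) a p from
    fun a p hp => (h (p + 1) p (by omega) hp a).1
  intro n
  induction n with
  | zero => intro p hp; omega
  | succ n ih =>
    intro p hpn hp a
    refine ⟨fun h => ?_, fun h => ?_⟩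
    · rw [← morseSubst_morseSubst_morseSeq] at h
      obtain ⟨p', a', rfl, h'⟩ := h.of_morseSubst
      exact (ih p' (by omega) (by omega) a').2 h'
    · obtain ⟨p', a', rfl, h'⟩ := h.of_morseSubst
      exact (ih p' (by omega) (by omega) a').1 h'

/-! ### Desubstitution of overlap-free sequences -/

/-- An overlap-free sequence has the same parity at all places where a letter is repeated. -/
theorem OverlapFree.ne_of_eq_of_odd {s : ℤ → Fin 2} (h : OverlapFree s) (k : ℕ) :
    ∀ n : ℤ, s n = s (n + 1) → s (n + 2 * k + 1) ≠ s (n + 2 * k + 2) := by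
  -- Excluding periods 1, 2 and 3 among the seven letters from n - 1 to n + 5 shows that a
  -- repetition at n forbids one at n + 1 and n + 3 and forces one at n + 2 or n + 4. The induction
  -- then moves by even distances.
  have win : ∀ n, (s n = s (n + 1) → s (n + 1) ≠ s (n + 2) ∧ s (n + 3) ≠ s (n + 4) ∧
      (s (n + 2) = s (n + 3) ∨ s (n + 4) = s (n + 5))) := by
    intro n
    have h1 : ∀ m, ¬ (s m = s (m + 1) ∧ s (m + 1) = s (m + 2)) := by
      rintro m ⟨e1, e2⟩
      refine h m 1 one_pos fun t ht => ?_
      interval_cases t <;> simp <;> [exact e1; (rw [e2]; congr 1; ring)]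
    have h2 : ∀ m, ¬ (s m = s (m + 2) ∧ s (m + 1) = s (m + 3) ∧ s (m + 2) = s (m + 4)) := by
      rintro m ⟨e1, e2, e3⟩
      refine h m 2 two_pos fun t ht => ?_
      interval_cases t <;> simp <;> [exact e1; (rw [e2]; congr 1; ring); (rw [e3]; congr 1; ring)]
    have h3 : ∀ m, ¬ (s m = s (m + 3) ∧ s (m + 1) = s (m + 4) ∧ s (m + 2) = s (m + 5) ∧
        s (m + 3) = s (m + 6)) := by
      rintro m ⟨e1, e2, e3, e4⟩
      refine h m 3 three_pos fun t ht => ?_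
      interval_cases t <;> simp <;>
        [exact e1; (rw [e2]; congr 1; ring); (rw [e3]; congr 1; ring); (rw [e4]; congr 1; ring)]
    have a0 := h1 (n - 1)
    have a1 := h1 n
    have a2 := h1 (n + 3)
    have a3 := h1 (n + 2)
    have b1 := h2 (n + 1)
    have c := h3 (n - 1)
    simp only [show n - 1 + 1 = n by ring, show n - 1 + 2 = n + 1 by ring,
      show n - 1 + 3 = n + 2 by ring, show n - 1 + 4 = n + 3 by ring,
      show n - 1 + 5 = n + 4 by ring, show n - 1 + 6 = n + 5 by ring,
      show n + 3 + 1 = n + 4 by ring, show n + 3 + 2 = n + 5 by ring,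
      show n + 2 + 1 = n + 3 by ring, show n + 2 + 2 = n + 4 by ring,
      show n + 1 + 1 = n + 2 by ring, show n + 1 + 2 = n + 3 by ring,
      show n + 1 + 3 = n + 4 by ring, show n + 1 + 4 = n + 5 by ring] at a0 a1 a2 a3 b1 c
    generalize s (n - 1) = x0 at *
    generalize s n = x1 at *
    generalize s (n + 1) = x2 at *
    generalize s (n + 2) = x3 at *
    generalize s (n + 3) = x4 at *
    generalize s (n + 4) = x5 at *
    generalize s (n + 5) = x6 at *
    clear h1 h2 h3 h
    decide +revert
  induction k using Nat.strong_induction_on with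
  | _ k ih =>
    intro n hn
    obtain ⟨w1, w2, w3⟩ := win n hn
    rcases k with _ | _ | k
    · simpa using w1
    · convert w2 using 2 <;> push_cast <;> ring
    · rcases w3 with w3 | w3
      · convert ih (k + 1) (by omega) (n + 2) (by rw [w3]; congr 1; ring) using 2 <;>
          push_cast <;> ring
      · convert ih k (by omega) (n + 4) (by rw [w3]; congr 1; ring) using 2 <;> push_cast <;> ring

/-- Every overlap-free sequence over two letters is, up to a shift, the image of an overlap-free
sequence under the substitution. -/
theorem OverlapFree.exists_morseSubst {s : ℤ → Fin 2} (h : OverlapFree s) :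
    ∃ (i : ℤ) (s' : ℤ → Fin 2), OverlapFree s' ∧ s = SymbolicDynamics.FullShift.shift i
      (_root_.morseSubst s') := by
  have hpar : ∀ n m, s n = s (n + 1) → s m = s (m + 1) → n % 2 = m % 2 := by
    have : ∀ n m, n ≤ m → s n = s (n + 1) → s m = s (m + 1) → n % 2 = m % 2 := by
      intro n m hnm hn hm
      by_contra hne
      have := h.ne_of_eq_of_odd ((m - n) / 2).toNat n hn
      rw [Int.toNat_of_nonneg (by omega)] at this
      rw [show n + 2 * ((m - n) / 2) + 1 = m by omega,
        show n + 2 * ((m - n) / 2) + 2 = m + 1 by omega] at this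
      exact this hm
    intro n m hn hm
    rcases le_total n m with hnm | hnm
    · exact this n m hnm hn hm
    · exact (this m n hnm hm hn).symm
  -- The cells are cut so that every repetition straddles a boundary.
  obtain ⟨i, hi⟩ : ∃ i : ℤ, ∀ n, s (2 * n - i) ≠ s (2 * n - i + 1) := by
    by_cases hD : ∃ n, s n = s (n + 1)
    · obtain ⟨n₀, hn₀⟩ := hD
      exact ⟨n₀ + 1, fun n hn => by have := hpar _ _ hn₀ hn; omega⟩
    · push Not at hD
      exact ⟨0, fun n => hD _⟩
  have key : s = SymbolicDynamics.FullShift.shift i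
      (_root_.morseSubst fun n => s (2 * n - i)) := by
    funext q
    rw [shift_apply]
    rcases Int.even_or_odd' (i + q) with ⟨m, hm | hm⟩
    · rw [hm, morseSubst_even]; congr 1; omega
    · rw [hm, morseSubst_odd, ← fin_two_ne_iff.1 (hi m)]; congr 1; omega
  refine ⟨i, _, ?_, key⟩
  apply OverlapFree.of_morseSubst
  have := h.shift (-i)
  rw [key, ← shift_add] at this
  simpa using this

theorem shift_iterate_morseSubst (n : ℕ) (s : ℤ → Fin 2) (m : ℤ) :
    shift (2 ^ n * m) (morseSubst^[n] s) = morseSubst^[n] (shift m s) := by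
  induction n generalizing s m with
  | zero => simp
  | succ n ih =>
    rw [Function.iterate_succ_apply, Function.iterate_succ_apply, ← shift_morseSubst, ← ih]
    ring_nf

theorem Int.ediv_two_pow_succ (q : ℤ) (n : ℕ) : q / 2 ^ (n + 1) = q / 2 ^ n / 2 := by
  rw [pow_succ, Int.ediv_ediv_of_nonneg (by positivity)]

theorem Int.emod_two_pow_succ {q q' : ℤ} {n : ℕ} (h : q % 2 ^ (n + 1) = q' % 2 ^ (n + 1)) :
    q % 2 ^ n = q' % 2 ^ n ∧ q / 2 ^ n % 2 = q' / 2 ^ n % 2 := by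
  have h1 : q ≡ q' [ZMOD 2 ^ (n + 1)] := h
  have h2 : q ≡ q' [ZMOD 2 ^ n] := h1.of_mul_right 2
  refine ⟨h2, ?_⟩
  obtain ⟨c, hc⟩ := h1.dvd
  have : q' = q + 2 ^ n * (2 * c) := by rw [pow_succ] at hc; linarith
  rw [this, Int.add_mul_ediv_left _ _ (by positivity)]
  omega

/-- A letter of θ^n(s) is the letter of s indexing its cell or the complement of it, and which of
the two depends only on the position in the cell. -/
theorem iterate_morseSubst_eq_iff (n : ℕ) {s t : ℤ → Fin 2} {q q' : ℤ}
    (h : q % 2 ^ n = q' % 2 ^ n) :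
    morseSubst^[n] s q = morseSubst^[n] t q' ↔ s (q / 2 ^ n) = t (q' / 2 ^ n) := by
  induction n generalizing s t with
  | zero => simp
  | succ n ih =>
    obtain ⟨h1, h2⟩ := Int.emod_two_pow_succ h
    rw [Function.iterate_succ_apply, Function.iterate_succ_apply, ih h1,
      Int.ediv_two_pow_succ, Int.ediv_two_pow_succ]
    unfold morseSubst
    rw [h2]
    split_ifs
    · rfl
    · exact sub_right_injective.eq_iff

theorem OverlapFree.iterate_morseSubst {s : ℤ → Fin 2} (h : OverlapFree s) (n : ℕ) :
    OverlapFree (_root_.morseSubst^[n] s) := by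
  induction n generalizing s with
  | zero => exact h
  | succ n ih => exact ih h.morseSubst

theorem OverlapFree.exists_iterate_morseSubst {s : ℤ → Fin 2} (h : OverlapFree s) (n : ℕ) :
    ∃ (i : ℤ) (s' : ℤ → Fin 2), OverlapFree s' ∧
      s = SymbolicDynamics.FullShift.shift i (_root_.morseSubst^[n] s') := by
  induction n with
  | zero => exact ⟨0, s, h, by simp⟩
  | succ n ih =>
    obtain ⟨i, s', hs', rfl⟩ := ih
    obtain ⟨j, s'', hs'', rfl⟩ := hs'.exists_morseSubst
    refine ⟨2 ^ n * j + i, s'', hs'', ?_⟩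
    rw [shift_add, Function.iterate_succ_apply, shift_iterate_morseSubst]

/-- After an odd shift, neighbours would differ across cells as well as inside them; an alternating
sequence has an overlap of period 2. -/
theorem OverlapFree.even_of_shift_morseSubst {s s' : ℤ → Fin 2} {i : ℤ} (hs : OverlapFree s)
    (h : SymbolicDynamics.FullShift.shift i (_root_.morseSubst s) = _root_.morseSubst s') :
    2 ∣ i := by
  by_contra hi
  have alt : ∀ q, _root_.morseSubst s q ≠ _root_.morseSubst s (q + 1) := by
    intro q
    rcases Int.emod_two_eq_zero_or_one q with hq | hq
    · exact morseSubst_ne s hq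
    · have := morseSubst_ne s' (q := q - i) (by omega)
      rw [← h, shift_apply, shift_apply] at this
      convert this using 2 <;> ring
  refine hs.morseSubst 0 2 two_pos fun t _ => ?_
  have h1 := fin_two_ne_iff.1 (alt (0 + t))
  have h2 := fin_two_ne_iff.1 (alt (0 + t + 1))
  rw [h1, sub_sub_cancel] at h2
  rw [← h2]
  congr 1

theorem OverlapFree.dvd_of_shift_iterate_morseSubst (n : ℕ) {s s' : ℤ → Fin 2} {i : ℤ}
    (hs : OverlapFree s)
    (h : SymbolicDynamics.FullShift.shift i (_root_.morseSubst^[n] s) =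
      _root_.morseSubst^[n] s') : (2 ^ n : ℤ) ∣ i := by
  induction n generalizing i with
  | zero => simp
  | succ n ih =>
    rw [Function.iterate_succ_apply', Function.iterate_succ_apply'] at h
    obtain ⟨j, rfl⟩ := (hs.iterate_morseSubst n).even_of_shift_morseSubst h
    rw [shift_morseSubst] at h
    rw [pow_succ']
    exact mul_dvd_mul_left 2 (ih (morseSubst_injective h))

/-! ### Minimality of the space of overlap-free sequences -/

/-- All two-letter words appear in every overlap-free sequence. -/
theorem OverlapFree.exists_pair {s : ℤ → Fin 2} (h : OverlapFree s) (a b : Fin 2) :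
    ∃ n, s n = a ∧ s (n + 1) = b := by
  obtain ⟨i, s', -, rfl⟩ := h.exists_iterate_morseSubst 3
  -- θ³ sends 0 to 01101001 and 1 to its complement; either word contains all four pairs.
  have key : ∃ n : Fin 7, _root_.morseSubst^[3] s' (n.1 : ℤ) = a ∧
      _root_.morseSubst^[3] s' ((n.1 : ℤ) + 1) = b := by
    simp only [Function.iterate_succ, Function.iterate_zero, Function.comp_apply, id_eq]
    unfold _root_.morseSubst
    simp only [Fin.exists_fin_succ, Fin.exists_fin_zero]
    norm_num
    generalize s' 0 = c
    decide +revert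
  obtain ⟨n, hn⟩ := key
  refine ⟨n.1 - i, ?_⟩
  simp only [shift_apply]
  rwa [show i + ((n.1 : ℤ) - i) = n.1 by ring, show i + ((n.1 : ℤ) - i + 1) = n.1 + 1 by ring]

/-- Every word of an overlap-free sequence appears in every other one. -/
theorem OverlapFree.exists_window {s t : ℤ → Fin 2} (hs : OverlapFree s) (ht : OverlapFree t)
    (N : ℕ) : ∃ n : ℤ, ∀ i : ℤ, |i| ≤ N → s (n + i) = t i := by
  -- A window of width 2N + 1 meets at most two cells of length 2^(2N+1), so it is determined by its
  -- position and one two-letter word.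
  obtain ⟨i, s', hs', rfl⟩ := hs.exists_iterate_morseSubst (2 * N + 1)
  obtain ⟨j, t', ht', rfl⟩ := ht.exists_iterate_morseSubst (2 * N + 1)
  have hK : ((2 * N + 1 : ℕ) : ℤ) < 2 ^ (2 * N + 1) := by exact_mod_cast Nat.lt_two_pow_self
  set K : ℤ := 2 ^ (2 * N + 1) with hKdef
  set d := (j - N) / K with hd
  obtain ⟨m, hm0, hm1⟩ := hs'.exists_pair (t' d) (t' (d + 1))
  refine ⟨K * (m - d) + j - i, fun e he => ?_⟩
  rw [abs_le] at he
  simp only [shift_apply]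
  have e1 : i + (K * (m - d) + j - i + e) = j + e + K * (m - d) := by ring
  rw [e1, iterate_morseSubst_eq_iff _ (Int.add_mul_emod_self_left _ _ _), ← hKdef,
    Int.add_mul_ediv_left _ _ (by omega)]
  have b1 := Int.mul_ediv_add_emod (j - N) K
  have b2 := Int.emod_nonneg (j - N) (b := K) (by omega)
  have b3 := Int.emod_lt_of_pos (j - N) (b := K) (by omega)
  rw [← hd] at b1
  have hcase : (j + e) / K = d ∨ (j + e) / K = d + 1 := by
    rcases lt_or_ge (j + e) (K * d + K) with hlt | hge
    · left
      refine Int.ediv_eq_iff_of_pos (by omega) |>.2 ⟨?_, ?_⟩ <;> linarith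
    · right
      refine Int.ediv_eq_iff_of_pos (by omega) |>.2 ⟨?_, ?_⟩ <;> push_cast at hK <;> linarith
  rcases hcase with hc | hc
  · rw [hc, ← hm0]; congr 1; ring
  · rw [hc, ← hm1]; congr 1; ring

theorem isClosed_setOf_overlapFree {A : Type*} [TopologicalSpace A] [DiscreteTopology A] :
    IsClosed {s : ℤ → A | OverlapFree s} := by
  have : {s : ℤ → A | OverlapFree s} = ⋂ (a : ℤ) (p : ℕ) (_ : 0 < p),
      (⋂ t ∈ Set.Iic p, {s : ℤ → A | s (a + (t : ℕ)) = s (a + t + p)})ᶜ := by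
    ext s
    simp [OverlapFree, IsOverlap]
  rw [this]
  refine isClosed_iInter fun a => isClosed_iInter fun p => isClosed_iInter fun _ => ?_
  rw [isClosed_compl_iff]
  refine (Set.finite_Iic p).isOpen_biInter fun t _ => ?_
  exact (isOpen_discrete (Set.diagonal A)).preimage
    (f := fun s : ℤ → A => (s (a + (t : ℕ)), s (a + t + p))) (by fun_prop)

theorem mem_closure_of_windows {A : Type*} [TopologicalSpace A] {Y : Set (ℤ → A)} {x : ℤ → A}
    (h : ∀ N : ℕ, ∃ y ∈ Y, ∀ i : ℤ, |i| ≤ N → y i = x i) : x ∈ closure Y := by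
  choose y hy hxy using h
  refine mem_closure_of_tendsto (f := y) (b := Filter.atTop) ?_ (Filter.Eventually.of_forall hy)
  rw [tendsto_pi_nhds]
  intro i
  refine tendsto_const_nhds.congr' ?_
  filter_upwards [Filter.eventually_ge_atTop i.natAbs] with N hN
  exact (hxy N i (by rw [Int.abs_eq_natAbs]; exact_mod_cast hN)).symm

/-- A closed shift-invariant set that contains one overlap-free sequence contains all. -/
theorem OverlapFree.mem_of_isClosed {Y : Set (ℤ → Fin 2)} (hY : IsClosed Y)
    (hinv : ∀ n, Set.MapsTo (SymbolicDynamics.FullShift.shift n) Y Y) {s t : ℤ → Fin 2}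
    (hs : OverlapFree s) (hsY : s ∈ Y) (ht : OverlapFree t) : t ∈ Y := by
  rw [← hY.closure_eq]
  refine mem_closure_of_windows fun N => ?_
  obtain ⟨n, hn⟩ := hs.exists_window ht N
  exact ⟨_, hinv n hsY, hn⟩

theorem mem_morseMinimalSet {s : ℤ → Fin 2} : s ∈ morseMinimalSet.carrier ↔ OverlapFree s := by
  constructor
  · intro h
    refine closure_minimal ?_ isClosed_setOf_overlapFree h
    rintro _ ⟨n, rfl⟩
    exact overlapFree_morseSeq.shift n
  · intro h
    refine overlapFree_morseSeq.mem_of_isClosed morseMinimalSet.isClosed morseMinimalSet.mapsTo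
      (subset_closure ⟨0, ?_⟩) h
    simp

/-! ### Towers over the overlap-free sequences -/

/-- `X` is the suspension of height `N` over the space of overlap-free sequences, embedded in the
full shift by `Φ`. -/
structure IsOverlapFreeTower {A : Type*} [TopologicalSpace A] (N : ℕ)
    (Φ : (ℤ → Fin 2) → ℤ → A) (X : Subshift A ℤ) : Prop where
  continuous : Continuous Φ
  shift_map : ∀ n s, Φ (shift n s) = shift (N * n) (Φ s)
  injOn : Set.InjOn Φ {s | OverlapFree s}
  dvd : ∀ s s' i, OverlapFree s → OverlapFree s' → shift i (Φ s) = Φ s' → (N : ℤ) ∣ i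
  mem_iff : ∀ x, x ∈ X.carrier ↔ ∃ s i, OverlapFree s ∧ x = shift i (Φ s)

/-- The shift on the suspension of height `N` over the space of overlap-free sequences. -/
def towerShift {N : ℕ} (hN : 0 < N) (z : {s : ℤ → Fin 2 // OverlapFree s} × Fin N) :
    {s : ℤ → Fin 2 // OverlapFree s} × Fin N :=
  if h : z.2.1 + 1 < N then (z.1, ⟨z.2.1 + 1, h⟩) else (⟨shift 1 z.1.1, z.1.2.shift 1⟩, ⟨0, hN⟩)

/-- `dvd` keeps the N levels disjoint and `shift_map` glues the top level to the bottom one. The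
inverse is continuous by compactness. -/
theorem IsOverlapFreeTower.exists_homeomorph {A : Type*} [TopologicalSpace A] [T2Space A]
    {N : ℕ} (hN : 0 < N) {Φ : (ℤ → Fin 2) → ℤ → A} {X : Subshift A ℤ}
    (h : IsOverlapFreeTower N Φ X) :
    ∃ F : ({s : ℤ → Fin 2 // OverlapFree s} × Fin N) ≃ₜ X.carrier,
      Function.Semiconj F (towerShift hN) (subshiftMap X) := by
  let f : ({s : ℤ → Fin 2 // OverlapFree s} × Fin N) → X.carrier := fun z =>
    ⟨shift (z.2.1 : ℤ) (Φ z.1.1), (h.mem_iff _).2 ⟨z.1.1, _, z.1.2, rfl⟩⟩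
  have : CompactSpace {s : ℤ → Fin 2 // OverlapFree s} :=
    isCompact_iff_compactSpace.1 isClosed_setOf_overlapFree.isCompact
  have hcont : Continuous f := by
    refine Continuous.subtype_mk ?_ _
    refine continuous_prod_of_discrete_right.2 fun r => ?_
    exact (continuous_shift (r.1 : ℤ)).comp (h.continuous.comp continuous_subtype_val)
  have hbij : Function.Bijective f := by
    constructor
    · rintro ⟨⟨s, hs⟩, r⟩ ⟨⟨s', hs'⟩, r'⟩ heq
      have heq' : shift (r.1 : ℤ) (Φ s) = shift (r'.1 : ℤ) (Φ s') := congrArg Subtype.val heq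
      have e : shift ((r.1 : ℤ) - r'.1) (Φ s) = Φ s' := by
        rw [sub_eq_add_neg, shift_add, heq', ← shift_add]
        simp
      have hd := h.dvd s s' _ hs hs' e
      have hr : (r.1 : ℤ) - r'.1 = 0 := by
        refine Int.eq_zero_of_abs_lt_dvd hd ?_
        have := r.2
        have := r'.2
        rw [abs_lt]
        omega
      rw [hr, shift_zero] at e
      have h1 := h.injOn hs hs' e
      have h2 : r = r' := Fin.ext (by omega)
      subst h1 h2
      rfl
    · rintro ⟨x, hx⟩
      obtain ⟨s, i, hs, rfl⟩ := (h.mem_iff x).1 hx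
      have hN' : (0 : ℤ) < N := by exact_mod_cast hN
      refine ⟨(⟨shift (i / N) s, hs.shift _⟩, ⟨(i % N).toNat, ?_⟩), Subtype.ext ?_⟩
      · have := Int.emod_lt_of_pos i hN'
        omega
      · change shift ((i % N).toNat : ℤ) (Φ (shift (i / N) s)) = _
        rw [Int.toNat_of_nonneg (Int.emod_nonneg _ hN'.ne'), h.shift_map, ← shift_add,
          Int.mul_ediv_add_emod]
  refine ⟨Continuous.homeoOfEquivCompactToT2 (f := Equiv.ofBijective f hbij) hcont, fun z => ?_⟩
  change f (towerShift hN z) = subshiftMap X (f z)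
  refine Subtype.ext ?_
  change shift ((towerShift hN z).2.1 : ℤ) (Φ (towerShift hN z).1.1) =
    shift 1 (shift (z.2.1 : ℤ) (Φ z.1.1))
  rw [← shift_add]
  unfold towerShift
  split_ifs with hz
  · simp
  · have : z.2.1 + 1 = N := by have := z.2.2; omega
    simp only [h.shift_map, Nat.cast_zero, shift_zero]
    congr 1
    omega

theorem IsOverlapFreeTower.topConjugate {A B : Type*} [TopologicalSpace A] [T2Space A]
    [TopologicalSpace B] [T2Space B] {N : ℕ} (hN : 0 < N) {Φ : (ℤ → Fin 2) → ℤ → A}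
    {Ψ : (ℤ → Fin 2) → ℤ → B} {X : Subshift A ℤ} {Y : Subshift B ℤ}
    (hX : IsOverlapFreeTower N Φ X) (hY : IsOverlapFreeTower N Ψ Y) : TopConjugate X Y := by
  obtain ⟨F, hF⟩ := hX.exists_homeomorph hN
  obtain ⟨G, hG⟩ := hY.exists_homeomorph hN
  refine ⟨F.symm.trans G, ?_⟩
  have hF' : Function.Semiconj F.symm (subshiftMap X) (towerShift hN) := fun x => by
    apply F.injective
    rw [hF]
    simp
  exact hG.comp_left hF'

theorem continuous_morseSubst : Continuous morseSubst := by
  refine continuous_pi fun q => ?_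
  unfold morseSubst
  split_ifs <;> fun_prop

/-- Having M as a tower of every height 2^n allows it to match the tower X for any block length. -/
theorem isOverlapFreeTower_morseMinimalSet (n : ℕ) :
    IsOverlapFreeTower (2 ^ n) morseSubst^[n] morseMinimalSet where
  continuous := continuous_morseSubst.iterate n
  shift_map m s := by simp [shift_iterate_morseSubst]
  injOn := (morseSubst_injective.iterate n).injOn
  dvd s s' i hs _ h := by simpa using hs.dvd_of_shift_iterate_morseSubst n h
  mem_iff x := by
    rw [mem_morseMinimalSet]
    constructor
    · intro hx
      obtain ⟨i, s', hs', h⟩ := hx.exists_iterate_morseSubst n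
      exact ⟨s', i, hs', h⟩
    · rintro ⟨s, i, hs, rfl⟩
      exact (hs.iterate_morseSubst n).shift i

/-! ### Block concatenations -/

/-- The blocks of the concatenation determined by the sequence `s` of distinguished blocks. -/
def morseCell {B : Type*} (C₀ C₁ C₀' C₁' : B) (s : ℤ → Fin 2) (n : ℤ) : B :=
  if n % 2 = 0 then ![C₀, C₁] (s (n / 2))
  else ![![C₁, C₁'], ![C₀', C₀]] (s (n / 2)) (s (n / 2 + 1))

theorem morseCell_even {B : Type*} (C₀ C₁ C₀' C₁' : B) (s : ℤ → Fin 2) (n : ℤ) :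
    morseCell C₀ C₁ C₀' C₁' s (2 * n) = ![C₀, C₁] (s n) := by
  simp [morseCell]

theorem morseCell_odd {B : Type*} (C₀ C₁ C₀' C₁' : B) (s : ℤ → Fin 2) (n : ℤ) :
    morseCell C₀ C₁ C₀' C₁' s (2 * n + 1) =
      ![![C₁, C₁'], ![C₀', C₀]] (s n) (s (n + 1)) := by
  have h1 : (2 * n + 1) % 2 = 1 := by omega
  have h2 : (2 * n + 1) / 2 = n := by omega
  simp [morseCell, h1, h2]

/-- The concatenation of blocks of length `L` determined by the sequence `s` of distinguished
blocks; the distinguished block of index `0` starts at the place `0`. -/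
def morseConcat {A : Type*} {L : ℕ} [NeZero L] (C₀ C₁ C₀' C₁' : Fin L → A)
    (s : ℤ → Fin 2) (q : ℤ) : A :=
  morseCell C₀ C₁ C₀' C₁' s (q / L) (Fin.ofNat L (q % L).toNat)

theorem morseConcat_apply {A : Type*} {L : ℕ} [NeZero L] (C₀ C₁ C₀' C₁' : Fin L → A)
    (s : ℤ → Fin 2) (n : ℤ) (i : Fin L) :
    morseConcat C₀ C₁ C₀' C₁' s (L * n + (i : ℕ)) = morseCell C₀ C₁ C₀' C₁' s n i := by
  have hi : ((i : ℕ) : ℤ) < L := by exact_mod_cast i.2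
  have h1 : (L * n + ((i : ℕ) : ℤ)) / L = n := by
    rw [add_comm, Int.add_mul_ediv_left _ _ (by omega), Int.ediv_eq_zero_of_lt (by omega) hi,
      zero_add]
  have h2 : (L * n + ((i : ℕ) : ℤ)) % L = (i : ℕ) := by
    rw [add_comm, Int.add_mul_emod_self_left, Int.emod_eq_of_lt (by omega) hi]
  simp [morseConcat, h1, h2]

theorem exists_block_coordinates (L : ℕ) [NeZero L] (q : ℤ) :
    ∃ (n : ℤ) (i : Fin L), q = L * n + (i : ℕ) := by
  have hL : (0 : ℤ) < L := by exact_mod_cast Nat.pos_of_neZero L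
  have h1 := Int.emod_lt_of_pos q hL
  have h0 := Int.emod_nonneg q hL.ne'
  refine ⟨q / L, ⟨(q % L).toNat, by omega⟩, ?_⟩
  simp only [Int.toNat_of_nonneg h0]
  exact (Int.mul_ediv_add_emod q L).symm

theorem shift_morseConcat {A : Type*} {L : ℕ} [NeZero L] (C₀ C₁ C₀' C₁' : Fin L → A)
    (s : ℤ → Fin 2) (m : ℤ) :
    morseConcat C₀ C₁ C₀' C₁' (shift m s) = shift ((2 * L : ℕ) * m)
      (morseConcat C₀ C₁ C₀' C₁' s) := by
  funext q
  obtain ⟨n, i, rfl⟩ := exists_block_coordinates L q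
  rw [shift_apply, show ((2 * L : ℕ) : ℤ) * m + (L * n + (i : ℕ)) = L * (2 * m + n) + (i : ℕ) by
    push_cast; ring, morseConcat_apply, morseConcat_apply]
  obtain ⟨j, rfl | rfl⟩ := Int.even_or_odd' n
  · rw [← mul_add, morseCell_even, morseCell_even, shift_apply]
  · rw [← add_assoc, ← mul_add, morseCell_odd, morseCell_odd, shift_apply, shift_apply, add_assoc]

theorem continuous_morseConcat {A : Type*} [TopologicalSpace A] {L : ℕ} [NeZero L]
    (C₀ C₁ C₀' C₁' : Fin L → A) : Continuous (morseConcat C₀ C₁ C₀' C₁') := by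
  refine continuous_pi fun q => ?_
  unfold morseConcat morseCell
  split_ifs
  · exact (continuous_of_discreteTopology
      (f := fun a : Fin 2 => ![C₀, C₁] a (Fin.ofNat L (q % L).toNat))).comp
      (continuous_apply (q / L / 2))
  · have hc : Continuous fun s : ℤ → Fin 2 => (s (q / L / 2), s (q / L / 2 + 1)) := by fun_prop
    exact (continuous_of_discreteTopology (f := fun a : Fin 2 × Fin 2 =>
      ![![C₁, C₁'], ![C₀', C₀]] a.1 a.2 (Fin.ofNat L (q % L).toNat))).comp hc

theorem cons_cons_injective {B : Type*} {C₀ C₁ : B} (h : C₀ ≠ C₁) :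
    Function.Injective ![C₀, C₁] := by
  intro a b hab
  fin_cases a <;> fin_cases b <;> simp_all

theorem morseConcat_injective {A : Type*} {L : ℕ} [NeZero L] {C₀ C₁ : Fin L → A}
    (h : C₀ ≠ C₁) (C₀' C₁' : Fin L → A) :
    Function.Injective (morseConcat C₀ C₁ C₀' C₁') := by
  intro s t hst
  funext n
  apply cons_cons_injective h
  funext i
  rw [← morseCell_even C₀ C₁ C₀' C₁' s, ← morseCell_even C₀ C₁ C₀' C₁' t,
    ← morseConcat_apply, hst, morseConcat_apply]

/-- As C₀ ≠ C₁, distinguished blocks correspond to letters and overlap-freeness transfers; the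
neighbour rule forces all other blocks. -/
theorem morseDecomposable_iff {A : Type*} {L : ℕ} [NeZero L] {C₀ C₁ C₀' C₁' : Fin L → A}
    (h : C₀ ≠ C₁) {x : ℤ → A} :
    MorseDecomposable C₀ C₁ C₀' C₁' x ↔
      ∃ s i, OverlapFree s ∧ x = shift i (morseConcat C₀ C₁ C₀' C₁' s) := by
  constructor
  · rintro ⟨c, ⟨p, hp⟩, -, heven, hBBb, hgap⟩
    have hs : ∀ n, ∃ a : Fin 2, c (2 * n) = ![C₀, C₁] a := fun n => by
      rcases heven n with e | e
      · exact ⟨0, e⟩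
      · exact ⟨1, e⟩
    choose s hs using hs
    refine ⟨s, -p, ?_, ?_⟩
    · rw [noBBb_iff_overlapFree] at hBBb
      simp only [hs] at hBBb
      exact (OverlapFree.comp_iff (cons_cons_injective h)).1 hBBb
    · have hc : ∀ n, c n = morseCell C₀ C₁ C₀' C₁' s n := by
        intro n
        obtain ⟨m, rfl | rfl⟩ := Int.even_or_odd' n
        · rw [morseCell_even, hs]
        · rw [morseCell_odd]
          have h1 := hs m
          have h2 := hs (m + 1)
          obtain ⟨g1, g2, g3, g4⟩ := hgap m
          rw [show 2 * (m + 1) = 2 * m + 2 by ring] at h2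
          rw [h1, h2] at g1 g2 g3 g4
          generalize s m = a at *
          generalize s (m + 1) = b at *
          fin_cases a <;> fin_cases b <;> simp_all
      funext q
      obtain ⟨n, i, hq⟩ := exists_block_coordinates L (-p + q)
      rw [shift_apply, hq, morseConcat_apply, ← hc, ← hp]
      congr 1
      linarith
  · rintro ⟨s, p, hs, rfl⟩
    refine ⟨morseCell C₀ C₁ C₀' C₁' s, ⟨-p, fun n i => ?_⟩, fun n => ?_, fun n => ?_, ?_,
      fun n => ?_⟩
    · rw [shift_apply, ← morseConcat_apply]
      congr 1
      ring
    · obtain ⟨m, rfl | rfl⟩ := Int.even_or_odd' n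
      · rw [morseCell_even]
        generalize s m = a
        fin_cases a <;> simp
      · rw [morseCell_odd]
        generalize s m = a
        generalize s (m + 1) = b
        fin_cases a <;> fin_cases b <;> simp
    · rw [morseCell_even]
      generalize s n = a
      fin_cases a <;> simp
    · rw [noBBb_iff_overlapFree]
      simp only [morseCell_even]
      exact (OverlapFree.comp_iff (cons_cons_injective h)).2 hs
    · rw [show 2 * n + 2 = 2 * (n + 1) by ring, morseCell_even, morseCell_even, morseCell_odd]
      generalize s n = a
      generalize s (n + 1) = b
      fin_cases a <;> fin_cases b <;> simp [h, h.symm]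

/-- A shift by 2L is absorbed into s, so 2L compact images suffice. -/
theorem isCompact_setOf_morseConcat {A : Type*} [TopologicalSpace A] {L : ℕ} [NeZero L]
    (C₀ C₁ C₀' C₁' : Fin L → A) :
    IsCompact {x | ∃ s i, OverlapFree s ∧ x = shift i (morseConcat C₀ C₁ C₀' C₁' s)} := by
  have : {x | ∃ s i, OverlapFree s ∧ x = shift i (morseConcat C₀ C₁ C₀' C₁' s)} =
      ⋃ r ∈ Set.Iio (2 * L), (fun s => shift ((r : ℕ) : ℤ) (morseConcat C₀ C₁ C₀' C₁' s)) ''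
        {s | OverlapFree s} := by
    ext x
    simp only [Set.mem_ofPred_eq, Set.mem_iUnion, Set.mem_image, Set.mem_Iio, exists_prop]
    constructor
    · rintro ⟨s, i, hs, rfl⟩
      have hN : (0 : ℤ) < (2 * L : ℕ) := by exact_mod_cast Nat.pos_of_neZero (2 * L)
      have h0 := Int.emod_nonneg i hN.ne'
      have h1 := Int.emod_lt_of_pos i hN
      refine ⟨(i % (2 * L : ℕ)).toNat, by omega, shift (i / (2 * L : ℕ)) s, hs.shift _, ?_⟩
      rw [shift_morseConcat, ← shift_add, Int.toNat_of_nonneg h0, Int.mul_ediv_add_emod]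
    · rintro ⟨r, -, s, hs, rfl⟩
      exact ⟨s, r, hs, rfl⟩
  rw [this]
  refine (Set.finite_Iio _).isCompact_biUnion fun r _ => ?_
  exact isClosed_setOf_overlapFree.isCompact.image
    ((continuous_shift _).comp (continuous_morseConcat _ _ _ _))

/-- One inclusion is the minimality of X, the other that of the space of overlap-free sequences. -/
theorem IsMinimalSet.mem_iff_morseConcat {A : Type*} [TopologicalSpace A] [T2Space A] {L : ℕ}
    [NeZero L] {C₀ C₁ C₀' C₁' : Fin L → A} {X : Subshift A ℤ} (hX : IsMinimalSet X)
    (h : ∃ x ∈ X.carrier, ∃ s i, OverlapFree s ∧ x = shift i (morseConcat C₀ C₁ C₀' C₁' s))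
    (x : ℤ → A) :
    x ∈ X.carrier ↔ ∃ s i, OverlapFree s ∧ x = shift i (morseConcat C₀ C₁ C₀' C₁' s) := by
  constructor
  · intro hx
    let Y : Subshift A ℤ :=
      { carrier := X.carrier ∩
          {x | ∃ s i, OverlapFree s ∧ x = shift i (morseConcat C₀ C₁ C₀' C₁' s)}
        isClosed := X.isClosed.inter (isCompact_setOf_morseConcat _ _ _ _).isClosed
        mapsTo := by
          rintro g x ⟨hx, s, i, hs, rfl⟩
          exact ⟨X.mapsTo g hx, s, i + g, hs, (shift_add _ _ _).symm⟩ }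
    have hY : Y.carrier = X.carrier := hX.2 Y h Set.inter_subset_left
    rw [← hY] at hx
    exact hx.2
  · rintro ⟨t, j, ht, rfl⟩
    obtain ⟨x₀, hx₀, s, i, hs, rfl⟩ := h
    refine X.mapsTo j ?_
    refine hs.mem_of_isClosed (Y := morseConcat C₀ C₁ C₀' C₁' ⁻¹' X.carrier)
      (X.isClosed.preimage (continuous_morseConcat _ _ _ _)) ?_ ?_ ht
    · intro n u hu
      rw [Set.mem_preimage, shift_morseConcat]
      exact X.mapsTo _ hu
    · have := X.mapsTo (-i) hx₀
      rw [← shift_add] at this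
      simpa using this

/-! ### Uniqueness of the phase, and (b) ⇒ (a) -/

theorem morseSeq_two_to_five :
    morseSeq 2 = 1 ∧ morseSeq 3 = 0 ∧ morseSeq 4 = 1 ∧ morseSeq 5 = 0 := by
  have h : ∀ n : ℕ, morseSeq (n : ℤ) = thueMorse n := fun _ => rfl
  have h2 := h 2
  have h3 := h 3
  have h4 := h 4
  have h5 := h 5
  simp [thueMorse] at h2 h3 h4 h5
  simp [h2, h3, h4, h5]

/-- The distinguished blocks and the gaps cannot change places. -/
theorem shift_morseConcat_morseSeq_ne {A : Type*} {L : ℕ} [NeZero L] {C₀ C₁ : Fin L → A}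
    (h : C₀ ≠ C₁) (C₀' C₁' : Fin L → A) (t : ℤ → Fin 2) :
    shift (L : ℤ) (morseConcat C₀ C₁ C₀' C₁' morseSeq) ≠ morseConcat C₀ C₁ C₀' C₁' t := by
  intro heq
  obtain ⟨j, hj⟩ := Function.ne_iff.1 h
  have e1 : ∀ n, ![![C₁, C₁'], ![C₀', C₀]] (morseSeq n) (morseSeq (n + 1)) j =
      ![C₀, C₁] (t n) j := by
    intro n
    rw [← morseCell_odd, ← morseCell_even C₀ C₁ C₀' C₁', ← morseConcat_apply,
      ← morseConcat_apply, ← heq, shift_apply]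
    congr 1
    ring
  have e2 : ∀ n, ![C₀, C₁] (morseSeq (n + 1)) j =
      ![![C₁, C₁'], ![C₀', C₀]] (t n) (t (n + 1)) j := by
    intro n
    rw [← morseCell_odd, ← morseCell_even C₀ C₁ C₀' C₁', ← morseConcat_apply,
      ← morseConcat_apply, ← heq, shift_apply]
    congr 1
    ring
  -- The letters 1010 have gaps C₀', C₁', C₀'. Comparing at j gives t 2 = t 4, and each remaining
  -- choice of t 2 and t 3 forces C₀ j = C₁ j.
  obtain ⟨m2, m3, m4, m5⟩ := morseSeq_two_to_five
  have a2 := e1 2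
  have a3 := e1 3
  have a4 := e1 4
  have b2 := e2 2
  have b3 := e2 3
  norm_num [m2, m3, m4, m5] at a2 a3 a4 b2 b3
  generalize t 2 = t2 at *
  generalize t 3 = t3 at *
  generalize t 4 = t4 at *
  fin_cases t2 <;> fin_cases t3 <;> fin_cases t4 <;> simp at a2 a3 a4 b2 b3 <;> grind

/-- The shift by i preserves the set of concatenations in phase 0. If 2^(k+1) did not divide i, then
gcd(i, 2^(k+1)) would divide 2^k, so the shift by 2^k would preserve this set too, exchanging
distinguished blocks and gaps. -/
theorem dvd_of_shift_morseConcat {A : Type*} [TopologicalSpace A] [T2Space A] {k : ℕ}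
    {C₀ C₁ : Fin (2 ^ k) → A} (h : C₀ ≠ C₁) (C₀' C₁' : Fin (2 ^ k) → A) {s s' : ℤ → Fin 2}
    {i : ℤ} (hs : OverlapFree s) (hs' : OverlapFree s')
    (heq : shift i (morseConcat C₀ C₁ C₀' C₁' s) = morseConcat C₀ C₁ C₀' C₁' s') :
    ((2 * 2 ^ k : ℕ) : ℤ) ∣ i := by
  -- The sequences t with this property form a closed shift-invariant set containing s.
  have step : ∀ t, OverlapFree t → ∃ t', OverlapFree t' ∧
      morseConcat C₀ C₁ C₀' C₁' t' = shift i (morseConcat C₀ C₁ C₀' C₁' t) := by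
    intro t ht
    refine hs.mem_of_isClosed (Y := (fun t => shift i (morseConcat C₀ C₁ C₀' C₁' t)) ⁻¹'
      (morseConcat C₀ C₁ C₀' C₁' '' {t | OverlapFree t})) ?_ ?_ ⟨s', hs', heq.symm⟩ ht
    · exact (isClosed_setOf_overlapFree.isCompact.image
        (continuous_morseConcat _ _ _ _)).isClosed.preimage
        ((continuous_shift _).comp (continuous_morseConcat _ _ _ _))
    · rintro n u ⟨u', hu', e⟩
      refine ⟨shift n u', OverlapFree.shift hu' n, ?_⟩
      simp only at e ⊢
      rw [shift_morseConcat, shift_morseConcat, e, ← shift_add, ← shift_add, add_comm]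
  have iter : ∀ (a : ℕ) (t), OverlapFree t → ∃ t', OverlapFree t' ∧
      morseConcat C₀ C₁ C₀' C₁' t' = shift (i * a) (morseConcat C₀ C₁ C₀' C₁' t) := by
    intro a
    induction a with
    | zero => exact fun t ht => ⟨t, ht, by simp⟩
    | succ a ih =>
      intro t ht
      obtain ⟨t', ht', e⟩ := ih t ht
      obtain ⟨t'', ht'', e'⟩ := step t' ht'
      refine ⟨t'', ht'', ?_⟩
      rw [e', e, ← shift_add]
      push_cast
      ring_nf
  by_contra hdvd
  obtain ⟨x, y, hxy⟩ : ∃ x y : ℤ, i * x + (2 ^ (k + 1) : ℕ) * y = 2 ^ k := by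
    have hg : Int.gcd i (2 ^ (k + 1) : ℕ) ∣ 2 ^ (k + 1) := by
      exact_mod_cast Int.gcd_dvd_right i (2 ^ (k + 1) : ℕ)
    obtain ⟨r, hr, hgr⟩ := (Nat.dvd_prime_pow Nat.prime_two).1 hg
    have hrk : r ≤ k := by
      by_contra hrk
      apply hdvd
      have : r = k + 1 := by omega
      rw [← pow_succ', ← this, ← hgr]
      exact Int.gcd_dvd_left _ _
    obtain ⟨c, hc⟩ := pow_dvd_pow (2 : ℤ) hrk
    have hb := Int.gcd_eq_gcd_ab i (2 ^ (k + 1) : ℕ)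
    rw [hgr] at hb
    push_cast at hb
    refine ⟨i.gcdA (2 ^ (k + 1)) * c, i.gcdB (2 ^ (k + 1)) * c, ?_⟩
    rw [hc, hb]
    push_cast
    ring
  set N : ℤ := ((2 ^ (k + 1) : ℕ) : ℤ) with hN
  have hNpos : 0 < N := by positivity
  -- `iter` needs a natural multiplier, so x is reduced modulo N; the leftover multiple of N is
  -- absorbed into a shift of t.
  obtain ⟨t, -, ht⟩ := iter (x % N).toNat morseSeq overlapFree_morseSeq
  rw [Int.toNat_of_nonneg (Int.emod_nonneg _ hNpos.ne')] at ht
  have hx := Int.mul_ediv_add_emod x N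
  refine shift_morseConcat_morseSeq_ne h C₀' C₁' (shift (i * (x / N) + y) t) ?_
  rw [shift_morseConcat, ht, ← shift_add]
  congr 1
  rw [show ((2 * 2 ^ k : ℕ) : ℤ) = N by rw [hN, pow_succ']]
  push_cast
  rw [← hxy]
  conv_lhs => rw [← hx]
  ring

theorem IsMinimalSet.topConjugate_morseMinimalSet {A : Type*} [TopologicalSpace A] [T2Space A]
    {k : ℕ} {C₀ C₁ C₀' C₁' : Fin (2 ^ k) → A} (h : C₀ ≠ C₁) {X : Subshift A ℤ}
    (hX : IsMinimalSet X) (hx : ∃ x ∈ X.carrier, MorseDecomposable C₀ C₁ C₀' C₁' x) :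
    TopConjugate X morseMinimalSet := by
  simp only [morseDecomposable_iff h] at hx
  refine IsOverlapFreeTower.topConjugate (N := 2 * 2 ^ k) (Φ := morseConcat C₀ C₁ C₀' C₁')
    (by positivity) ?_ (by rw [← pow_succ']; exact isOverlapFreeTower_morseMinimalSet (k + 1))
  exact
    { continuous := continuous_morseConcat _ _ _ _
      shift_map := fun n s => shift_morseConcat _ _ _ _ s n
      injOn := (morseConcat_injective h _ _).injOn
      dvd := fun s s' i hs hs' => dvd_of_shift_morseConcat h _ _ hs hs'
      mem_iff := hX.mem_iff_morseConcat hx }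

/-! ### Sliding block codes, and (a) ⇒ (b) -/

theorem semiconj_subshiftMap_shift {A B : Type*} [TopologicalSpace A] [TopologicalSpace B]
    {X : Subshift A ℤ} {Y : Subshift B ℤ} {f : X.carrier → Y.carrier}
    (hf : Function.Semiconj f (subshiftMap X) (subshiftMap Y)) (n : ℤ) {x y : X.carrier}
    (hxy : y.1 = shift n x.1) : (f y).1 = shift n (f x).1 := by
  have hone : ∀ x y : X.carrier, y.1 = shift 1 x.1 → (f y).1 = shift 1 (f x).1 := by
    intro x y h
    have : y = subshiftMap X x := Subtype.ext h
    rw [this]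
    exact congrArg Subtype.val (hf x)
  induction n using Int.induction_on generalizing y with
  | zero =>
    rw [shift_zero] at hxy ⊢
    rw [Subtype.ext hxy]
  | succ i ih =>
    rw [shift_add, ← ih (y := ⟨_, X.mapsTo i x.2⟩) rfl]
    exact hone _ _ (by rw [hxy, shift_add])
  | pred i ih =>
    have h1 := hone y ⟨_, X.mapsTo (-i : ℤ) x.2⟩ (by rw [hxy, ← shift_add]; simp)
    rw [ih rfl] at h1
    rw [sub_eq_add_neg, shift_add, h1, ← shift_add]
    simp

/-- Curtis–Hedlund–Lyndon: a continuous map between subshifts that commutes with the shift is a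
sliding block code. -/
theorem exists_radius {A B : Type*} [Finite A] [TopologicalSpace A] [DiscreteTopology A]
    [TopologicalSpace B] [DiscreteTopology B] {X : Subshift A ℤ} {Y : Subshift B ℤ}
    {f : X.carrier → Y.carrier} (hcont : Continuous f)
    (hf : Function.Semiconj f (subshiftMap X) (subshiftMap Y)) :
    ∃ r : ℕ, ∀ (x y : X.carrier) (n m : ℤ),
      (∀ i : ℤ, |i| ≤ r → x.1 (n + i) = y.1 (m + i)) → (f x).1 n = (f y).1 m := by
  have : CompactSpace X.carrier := isCompact_iff_compactSpace.1 X.isClosed.isCompact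
  have hloc : ∀ x : X.carrier, ∃ r : ℕ, ∀ y : X.carrier,
      (∀ i : ℤ, |i| ≤ r → y.1 i = x.1 i) → (f y).1 0 = (f x).1 0 := by
    intro x
    by_contra hcon
    push Not at hcon
    choose y hy hne using hcon
    have hlim : Filter.Tendsto y Filter.atTop (nhds x) := by
      rw [tendsto_subtype_rng, tendsto_pi_nhds]
      intro i
      refine tendsto_const_nhds.congr' ?_
      filter_upwards [Filter.eventually_ge_atTop i.natAbs] with N hN
      exact (hy N i (by rw [Int.abs_eq_natAbs]; exact_mod_cast hN)).symm
    have hlim' : Filter.Tendsto (fun N => (f (y N)).1 0) Filter.atTop (nhds ((f x).1 0)) :=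
      (((continuous_apply (0 : ℤ)).comp (continuous_subtype_val.comp hcont)).tendsto x).comp hlim
    rw [nhds_discrete, Filter.tendsto_pure] at hlim'
    obtain ⟨N, hN⟩ := hlim'.exists
    exact hne N hN
  choose r hr using hloc
  have hopen : ∀ x : X.carrier,
      IsOpen {y : X.carrier | ∀ i ∈ Finset.Icc (-(r x : ℤ)) (r x), y.1 i = x.1 i} := fun x =>
    (isOpen_cylinder (Finset.Icc (-(r x : ℤ)) (r x)) x.1).preimage continuous_subtype_val
  obtain ⟨T, hT⟩ := isCompact_univ.elim_finite_subcover _ hopen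
    fun x _ => Set.mem_iUnion.2 ⟨x, fun _ _ => rfl⟩
  have hzero : ∀ x y : X.carrier, (∀ i : ℤ, |i| ≤ (T.sup r : ℕ) → x.1 i = y.1 i) →
      (f x).1 0 = (f y).1 0 := by
    intro x y hxy
    obtain ⟨z, hzT, hz⟩ := Set.mem_iUnion₂.1 (hT (Set.mem_univ x))
    have hx : ∀ i : ℤ, |i| ≤ r z → x.1 i = z.1 i := fun i hi =>
      hz i (Finset.mem_Icc.2 (abs_le.1 hi))
    have hle : ((r z : ℕ) : ℤ) ≤ (T.sup r : ℕ) := by exact_mod_cast Finset.le_sup hzT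
    rw [hr z x hx, hr z y fun i hi => by rw [← hxy i (hi.trans hle), hx i hi]]
  refine ⟨T.sup r, fun x y n m hxy => ?_⟩
  have := hzero ⟨shift n x.1, X.mapsTo n x.2⟩ ⟨shift m y.1, X.mapsTo m y.2⟩ hxy
  rw [semiconj_subshiftMap_shift hf n (x := x) (y := ⟨_, X.mapsTo n x.2⟩) rfl,
    semiconj_subshiftMap_shift hf m (x := y) (y := ⟨_, X.mapsTo m y.2⟩) rfl] at this
  simpa using this

theorem exists_morseDecomposable_of_topConjugate {A : Type*} [Finite A] [TopologicalSpace A]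
    [DiscreteTopology A] {X : Subshift A ℤ} (hX : TopConjugate X morseMinimalSet) :
    ∃ (k : ℕ) (C₀ C₁ C₀' C₁' : Fin (2 ^ k) → A), C₀ ≠ C₁ ∧
      ∃ x ∈ X.carrier, MorseDecomposable C₀ C₁ C₀' C₁' x := by
  obtain ⟨h, hh⟩ := hX
  have hg : Function.Semiconj h.symm (subshiftMap morseMinimalSet) (subshiftMap X) := fun y => by
    apply h.injective
    rw [hh]
    simp
  obtain ⟨r', hr'⟩ := exists_radius h.continuous hh
  obtain ⟨r, hr⟩ := exists_radius h.symm.continuous hg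
  -- As 2r < 2^k, a block offset by r is computed from two cells only; as 2r' < 2^k, it contains a
  -- full window of the code of `h`.
  obtain ⟨k, hk⟩ : ∃ k : ℕ, 2 * r + 2 * r' < 2 ^ k := ⟨_, Nat.lt_two_pow_self⟩
  set u := morseSubst morseSeq with hu
  have hufree : OverlapFree u := overlapFree_morseSeq.morseSubst
  have hy : morseSubst^[k] u ∈ morseMinimalSet.carrier :=
    mem_morseMinimalSet.2 (hufree.iterate_morseSubst k)
  set x := h.symm ⟨_, hy⟩ with hx
  have hkZ : (2 * r + 2 * r' : ℤ) < 2 ^ k := by exact_mod_cast hk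
  set K : ℤ := 2 ^ k with hK
  have hblock : ∀ (j j' : ℤ), u j = u j' → u (j + 1) = u (j' + 1) → ∀ i : ℤ, 0 ≤ i → i < K →
      x.1 (K * j + r + i) = x.1 (K * j' + r + i) := by
    intro j j' h0 h1 i hi0 hiK
    refine hr _ _ _ _ fun e he => ?_
    rw [abs_le] at he
    have e1 : ∀ j : ℤ, K * j + r + i + e = (r + i + e) + K * j := fun j => by ring
    simp only [e1]
    rw [iterate_morseSubst_eq_iff _ (by rw [← hK]; simp), ← hK,
      Int.add_mul_ediv_left _ _ (by omega), Int.add_mul_ediv_left _ _ (by omega)]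
    rcases lt_or_ge (r + i + e) K with hlt | hge
    · rw [Int.ediv_eq_zero_of_lt (by omega) hlt, zero_add, zero_add, h0]
    · have : (r + i + e) / K = 1 := by
        rw [Int.ediv_eq_iff_of_pos (by omega)]
        omega
      rw [this, add_comm, h1, add_comm]
  choose n hn0 hn1 using hufree.exists_pair
  let D : Fin 2 → Fin 2 → Fin (2 ^ k) → A := fun a b i => x.1 (K * n a b + r + (i : ℕ))
  have hD : ∀ (j : ℤ) (i : Fin (2 ^ k)),
      x.1 (K * j + r + (i : ℕ)) = D (u j) (u (j + 1)) i := fun j i =>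
    hblock _ _ (hn0 _ _).symm (hn1 _ _).symm _ (by positivity) (by rw [hK]; exact_mod_cast i.2)
  -- From the window of radius r' about offset r + r', `h` recovers a letter of cell `n a b`, hence
  -- a. Equal blocks would give 0 = 1.
  have hne : D 0 1 ≠ D 1 0 := by
    intro heq
    have hwin : ∀ i : ℤ, |i| ≤ r' →
        x.1 (K * n 0 1 + r + r' + i) = x.1 (K * n 1 0 + r + r' + i) := by
      intro i hi
      rw [abs_le] at hi
      have hlt : (r' + i).toNat < 2 ^ k := by omega
      have := congrFun heq ⟨_, hlt⟩
      simp only [D, Int.toNat_of_nonneg (show 0 ≤ r' + i by omega)] at this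
      rwa [← add_assoc, ← add_assoc] at this
    have := hr' _ _ _ _ hwin
    rw [hx, h.apply_symm_apply] at this
    have e1 : ∀ j : ℤ, K * j + r + r' = (r + r') + K * j := fun j => by ring
    simp only [e1] at this
    rw [iterate_morseSubst_eq_iff _ (by rw [← hK]; simp), ← hK,
      Int.add_mul_ediv_left _ _ (by omega), Int.add_mul_ediv_left _ _ (by omega),
      Int.ediv_eq_zero_of_lt (by omega) (by omega), zero_add, zero_add, hn0, hn0] at this
    exact absurd this (by decide)
  -- Between letters a, b of m, the straddling pair of u is (1 - a, b): it is 00 for ab = 10 and 11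
  -- for ab = 01, which dictates C₀' and C₁'.
  refine ⟨k, D 0 1, D 1 0, D 0 0, D 1 1, hne, x.1, x.2, ?_⟩
  rw [morseDecomposable_iff hne]
  refine ⟨morseSeq, -r, overlapFree_morseSeq, ?_⟩
  have hcell : ∀ j, morseCell (D 0 1) (D 1 0) (D 0 0) (D 1 1) morseSeq j =
      D (u j) (u (j + 1)) := by
    intro j
    obtain ⟨m, rfl | rfl⟩ := Int.even_or_odd' j
    · rw [morseCell_even, hu, morseSubst_even, morseSubst_odd]
      generalize morseSeq m = a
      fin_cases a <;> rfl
    · rw [morseCell_odd, hu, morseSubst_odd, show 2 * m + 1 + 1 = 2 * (m + 1) by ring,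
        morseSubst_even]
      generalize morseSeq m = a
      generalize morseSeq (m + 1) = b
      fin_cases a <;> fin_cases b <;> rfl
  funext q
  obtain ⟨j, i, hq⟩ := exists_block_coordinates (2 ^ k) (-r + q)
  rw [shift_apply, hq, morseConcat_apply, hcell, ← hD]
  push_cast at hq
  exact congrArg x.1 (by rw [hK]; linarith)

theorem mainTheorem2 {A : Type*} [Finite A] [TopologicalSpace A] [DiscreteTopology A]
    (X : Subshift A ℤ) (hX : IsMinimalSet X) :
    (TopConjugate X morseMinimalSet ↔
      ∃ (k : ℕ) (C₀ C₁ C₀' C₁' : Fin (2 ^ k) → A), C₀ ≠ C₁ ∧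
        ∃ x ∈ X.carrier, MorseDecomposable C₀ C₁ C₀' C₁' x) ∧
    (TopConjugate X morseMinimalSet ↔
      ∃ (k : ℕ) (C₀ C₁ C₀' C₁' : Fin (2 ^ k) → A), C₀ ≠ C₁ ∧
        ∀ x ∈ X.carrier, MorseDecomposable C₀ C₁ C₀' C₁' x) ∧
    (∀ (k : ℕ) (C₀ C₁ C₀' C₁' : Fin (2 ^ k) → A), C₀ ≠ C₁ →
      (∃ x ∈ X.carrier, MorseDecomposable C₀ C₁ C₀' C₁' x) →
        ∀ x ∈ X.carrier, MorseDecomposable C₀ C₁ C₀' C₁' x) := by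
  have hall : ∀ (k : ℕ) (C₀ C₁ C₀' C₁' : Fin (2 ^ k) → A), C₀ ≠ C₁ →
      (∃ x ∈ X.carrier, MorseDecomposable C₀ C₁ C₀' C₁' x) →
        ∀ x ∈ X.carrier, MorseDecomposable C₀ C₁ C₀' C₁' x := by
    intro k C₀ C₁ C₀' C₁' h hx x hxX
    simp only [morseDecomposable_iff h] at hx ⊢
    exact (hX.mem_iff_morseConcat hx x).1 hxX
  refine ⟨⟨exists_morseDecomposable_of_topConjugate, ?_⟩, ⟨fun h => ?_, ?_⟩, hall⟩
  · rintro ⟨k, C₀, C₁, C₀', C₁', h, hx⟩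
    exact hX.topConjugate_morseMinimalSet h hx
  · obtain ⟨k, C₀, C₁, C₀', C₁', h, hx⟩ := exists_morseDecomposable_of_topConjugate h
    exact ⟨k, C₀, C₁, C₀', C₁', h, hall k _ _ _ _ h hx⟩
  · rintro ⟨k, C₀, C₁, C₀', C₁', h, hx⟩
    obtain ⟨x, hxX⟩ := hX.1
    exact hX.topConjugate_morseMinimalSet h ⟨x, hxX, hx x hxX⟩
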